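/- Let $R_0$ be a commutative Noetherian domain, let $S=R_0[U_1,\dots,U_s]$ be graded by $\deg U_i=d_i$ with positive integers $d_1,\dots,d_s$ (and $R_0$ in degree $0$), let $I\subseteq S$ be an ideal generated by homogeneous elements $f_1,\dots,f_r$, let $R=S/I$ with the induced grading, and let $R_+$ be the ideal of $R$ generated by the homogeneous elements of positive degree. Let $\mathfrak c(I)\subseteq R_0$ be the content of $I$, that is, the ideal of $R_0$ generated by all coefficients of all elements of $I$. Put $$\mathcal D=\Bigl\{\sum_{i=1}^s\lambda_i d_i \;:\; \lambda_i\in\mathbb Z,\ \lambda_i\ge 1\Bigr\}.$$ Let $H^s_{R_+}(R)=\bigoplus_{n\in\mathbb Z}H^s_{R_+}(R)_n$ be the $s$-th local cohomology module of $R$ with support in $R_+$, with its natural grading, computed by the graded Čech complex of $R$ on the images of $U_1,\dots,U_s$. Then the following three conditions are equivalent: 1. $\mathfrak c(I)=R_0$; 2. $H^s_{R_+}(R)_{-d}=0$ for some $d\in\mathcal D$; 3. $H^s_{R_+}(R)_{-d}=0$ for all $d\in\mathcal D$. A $\mathbb Z$-indexed family $(T_n)$ of modules is called asymptotically gap-free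 if either $T_n=0$ for all $n\ll 0$ or $T_n\ne 0$ for all $n\ll 0$. Let $g=\gcd(d_1,\dots,d_s)$. Consequently, $H^s_{R_+}(R)$ is asymptotically gap-free with respect to the degrees divisible by $g$: $H^s_{R_+}(R)_n=0$ whenever $g\nmid n$, and the family $\bigl(H^s_{R_+}(R)_{gn}\bigr)_{n\in\mathbb Z}$ is asymptotically gap-free. In particular, if $g=1$ (for example, if all $d_i=1$), then $H^s_{R_+}(R)$ itself is asymptotically gap-free. -/

import Mathlib

noncomputable section

namespace GradedCech

variable {k A : Type*} [CommRing k] [CommRing A] [Algebra k A] {s : ℕ}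

/-- The monomial `∏ i ∈ σ, x i` attached to a set `σ` of indices. -/
def xProd (x : Fin s → A) (σ : Finset (Fin s)) : A := ∏ i ∈ σ, x i

/-- The localization of `A` at the powers of `∏ i ∈ σ, x i`. -/
abbrev Loc (x : Fin s → A) (σ : Finset (Fin s)) : Type _ := Localization.Away (xProd x σ)

theorem isUnit_xProd (x : Fin s → A) {σ τ : Finset (Fin s)} (h : σ ⊆ τ) :
    IsUnit (algebraMap A (Loc x τ) (xProd x σ)) :=
  isUnit_of_dvd_unit (map_dvd _ (Finset.prod_dvd_prod_of_subset _ _ _ h))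
    (IsLocalization.Away.algebraMap_isUnit (xProd x τ))

/-- The canonical `A`-algebra map `A_{x_σ} → A_{x_τ}` for `σ ⊆ τ`. -/
def res (x : Fin s → A) {σ τ : Finset (Fin s)} (h : σ ⊆ τ) : Loc x σ →ₐ[A] Loc x τ :=
  { Localization.awayLift (algebraMap A (Loc x τ)) (xProd x σ) (isUnit_xProd x h) with
    commutes' := fun a => IsLocalization.Away.lift_eq (xProd x σ) (isUnit_xProd x h) a }

/-- The `p`-th term `⨁_{|σ| = p} A_{x_σ}` of the Čech complex of `A` with respect to `x`
(the term for `p = 0` is `A` itself, localized at `1`). -/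
abbrev Cochain (x : Fin s → A) (p : ℕ) : Type _ :=
  (σ : {σ : Finset (Fin s) // σ.card = p}) → Loc x σ.1

/-- The face of `τ` obtained by deleting the vertex `i`. -/
def face {p : ℕ} (τ : {τ : Finset (Fin s) // τ.card = p + 1}) (i : {i // i ∈ τ.1}) :
    {σ : Finset (Fin s) // σ.card = p} :=
  ⟨τ.1.erase i.1, by rw [Finset.card_erase_of_mem i.2, τ.2]; rfl⟩

theorem face_subset {p : ℕ} (τ : {τ : Finset (Fin s) // τ.card = p + 1}) (i : {i // i ∈ τ.1}) :
    (face τ i).1 ⊆ τ.1 := Finset.erase_subset _ _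

/-- The sign `(-1)^m`, where `m` is the position of `i` in `τ` (counted from `0`). -/
def sgn (τ : Finset (Fin s)) (i : Fin s) : ℤ := (-1) ^ (τ.filter (· < i)).card

/-- The Čech differential: `(δ c)_τ = ∑_{i ∈ τ} ± c_{τ ∖ {i}}`, with the alternating signs. -/
def delta (x : Fin s → A) (p : ℕ) : Cochain x p →ₗ[A] Cochain x (p + 1) :=
  LinearMap.pi fun τ => ∑ i : {i // i ∈ τ.1},
    sgn τ.1 i.1 • ((res x (face_subset τ i)).toLinearMap ∘ₗ LinearMap.proj (face τ i))

theorem res_res (x : Fin s → A) {σ τ υ : Finset (Fin s)} (h : σ ⊆ τ) (h' : τ ⊆ υ)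
    (c : Loc x σ) : res x h' (res x h c) = res x (h.trans h') c := by
  have : ((res x h').comp (res x h)) = res x (h.trans h') := by
    apply AlgHom.coe_ringHom_injective
    apply IsLocalization.ringHom_ext (Submonoid.powers (xProd x σ))
    ext a
    simp
  exact DFunLike.congr_fun this c

theorem sgn_swap (τ : Finset (Fin s)) {i j : Fin s} (hi : i ∈ τ) (_hj : j ∈ τ) (h : i < j) :
    sgn τ i * sgn (τ.erase i) j = - (sgn τ j * sgn (τ.erase j) i) := by
  have h1 : (τ.erase i).filter (· < j) = (τ.filter (· < j)).erase i := by
    ext a; simp; tauto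
  have h2 : (τ.erase j).filter (· < i) = τ.filter (· < i) := by
    ext a; simp only [Finset.mem_filter, Finset.mem_erase]
    constructor
    · tauto
    · rintro ⟨ha, hb⟩; exact ⟨⟨(hb.trans h).ne, ha⟩, hb⟩
  have h3 : i ∈ τ.filter (· < j) := by simp [hi, h]
  obtain ⟨m, hm⟩ : ∃ m, (τ.filter (· < j)).card = m + 1 :=
    ⟨_, (Nat.succ_pred_eq_of_pos (Finset.card_pos.2 ⟨i, h3⟩)).symm⟩
  simp only [sgn, h1, h2, Finset.card_erase_of_mem h3, hm, Nat.add_sub_cancel]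
  ring

/-- The Čech complex is a complex. -/
theorem delta_delta (x : Fin s → A) (p : ℕ) (c : Cochain x p) :
    delta x (p + 1) (delta x p c) = 0 := by
  funext τ
  have key : ∀ (σ σ' : {σ : Finset (Fin s) // σ.card = p}) (h : σ = σ') (h1 : σ.1 ⊆ τ.1)
      (h2 : σ'.1 ⊆ τ.1), res x h1 (c σ) = res x h2 (c σ') := by
    rintro σ _ rfl _ _; rfl
  simp only [delta, LinearMap.pi_apply, LinearMap.sum_apply, LinearMap.smul_apply,
    LinearMap.comp_apply, LinearMap.proj_apply, AlgHom.toLinearMap_apply, map_sum, map_zsmul,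
    Finset.smul_sum, smul_smul, Pi.zero_apply, res_res]
  rw [Finset.sum_sigma']
  have hne : ∀ a : (i : {i // i ∈ τ.1}) × {j // j ∈ (face τ i).1}, a.1.1 ≠ a.2.1 :=
    fun a h => (Finset.mem_erase.1 a.2.2).1 h.symm
  refine Finset.sum_involution
    (fun a _ => ⟨⟨a.2.1, (Finset.mem_erase.1 a.2.2).2⟩,
      ⟨a.1.1, Finset.mem_erase.2 ⟨hne a, a.1.2⟩⟩⟩) ?_ ?_ ?_ ?_
  · rintro ⟨⟨i, hi⟩, ⟨j, hj⟩⟩ -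
    have hj' := Finset.mem_erase.1 hj
    rw [key (face (face τ ⟨j, hj'.2⟩) ⟨i, Finset.mem_erase.2 ⟨hj'.1.symm, hi⟩⟩)
      (face (face τ ⟨i, hi⟩) ⟨j, hj⟩) (Subtype.ext (by simp [face, Finset.erase_right_comm]))
      _ ((face_subset _ _).trans (face_subset _ _)), ← add_smul]
    have : sgn τ.1 i * sgn (τ.1.erase i) j + sgn τ.1 j * sgn (τ.1.erase j) i = 0 := by
      rcases lt_or_gt_of_ne hj'.1 with h | h
      · rw [sgn_swap τ.1 hj'.2 hi h]; ring
      · rw [sgn_swap τ.1 hi hj'.2 h]; ring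
    simp only [face, this, zero_smul]
  · intro a _ _ h
    exact hne a (congrArg (fun b => b.1.1) h).symm
  · simp
  · simp

/-- The coboundaries in `C^p` (for `p = 0` the complex has nothing to the left). -/
def coboundaries (x : Fin s → A) : (p : ℕ) → Submodule A (Cochain x p)
  | 0 => ⊥
  | p + 1 => LinearMap.range (delta x p)

/-- The local cohomology module `H^p_J(A)` of the ideal `J = (x_1, …, x_s)`, computed by the
Čech complex: cocycles modulo coboundaries. -/
abbrev H (x : Fin s → A) (p : ℕ) : Type _ :=
  LinearMap.ker (delta x p) ⧸ (coboundaries x p).submoduleOf (LinearMap.ker (delta x p))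

/-- The homogeneous component of degree `n ∈ ℤ` of `A_{x_σ}`, where `A` is graded by `𝒜` and
`x i` is homogeneous of degree `d i`: it consists of the fractions `a / x_σ ^ j` with `a`
homogeneous of degree `m` and `m - j * deg x_σ = n`. -/
def locDegree (𝒜 : ℕ → Submodule k A) (x : Fin s → A) (d : Fin s → ℕ)
    (σ : Finset (Fin s)) (n : ℤ) : Submodule k (Loc x σ) :=
  Submodule.span k {z | ∃ (m j : ℕ) (a : A), a ∈ 𝒜 m ∧ (m : ℤ) - j * ∑ i ∈ σ, (d i : ℤ) = n ∧
    z = Localization.mk a (⟨xProd x σ ^ j, j, rfl⟩ : Submonoid.powers (xProd x σ))}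

/-- The homogeneous component of degree `n` of the `p`-th term of the Čech complex. -/
def cochainDegree (𝒜 : ℕ → Submodule k A) (x : Fin s → A) (d : Fin s → ℕ)
    (p : ℕ) (n : ℤ) : Submodule k (Cochain x p) :=
  Submodule.pi Set.univ fun σ => locDegree 𝒜 x d σ.1 n

/-- The homogeneous component `H^p_J(A)_n` of degree `n`: the classes of the homogeneous
cocycles of degree `n`. -/
def HDegree (𝒜 : ℕ → Submodule k A) (x : Fin s → A) (d : Fin s → ℕ)
    (p : ℕ) (n : ℤ) : Submodule k (H x p) :=
  ((cochainDegree 𝒜 x d p n).comap ((LinearMap.ker (delta x p)).subtype.restrictScalars k)).map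
    (((coboundaries x p).submoduleOf (LinearMap.ker (delta x p))).mkQ.restrictScalars k)

end GradedCech

namespace TopLocalCohomology

variable {R₀ : Type*} [CommRing R₀] {s : ℕ}

/-- The content of an ideal `I` of `R₀[U_1, …, U_s]`: the ideal of `R₀` generated by all the
coefficients of all the elements of `I`. -/
def content (I : Ideal (MvPolynomial (Fin s) R₀)) : Ideal R₀ :=
  Ideal.span {a | ∃ f ∈ I, ∃ m, MvPolynomial.coeff m f = a}

/-- The grading of `R = R₀[U_1, …, U_s] / I` induced by `deg U_i = d i`. -/
def grading (d : Fin s → ℕ) (I : Ideal (MvPolynomial (Fin s) R₀)) (n : ℕ) :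
    Submodule R₀ (MvPolynomial (Fin s) R₀ ⧸ I) :=
  (MvPolynomial.weightedHomogeneousSubmodule R₀ d n).map (Ideal.Quotient.mkₐ R₀ I).toLinearMap

/-- The images in `R` of the indeterminates. -/
def gen (I : Ideal (MvPolynomial (Fin s) R₀)) (i : Fin s) : MvPolynomial (Fin s) R₀ ⧸ I :=
  Ideal.Quotient.mk I (MvPolynomial.X i)

/-- The ideal `R_+` of `R` generated by the homogeneous elements of positive degree. -/
def irrelevant (d : Fin s → ℕ) (I : Ideal (MvPolynomial (Fin s) R₀)) :
    Ideal (MvPolynomial (Fin s) R₀ ⧸ I) :=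
  Ideal.span {a | ∃ n, 0 < n ∧ a ∈ grading d I n}

/-- The images of the indeterminates generate `R_+`, so that their Čech complex computes the
local cohomology with support in `R_+`. -/
theorem span_gen (d : Fin s → ℕ) (hd : ∀ i, 0 < d i) (I : Ideal (MvPolynomial (Fin s) R₀)) :
    Ideal.span (Set.range (gen I)) = irrelevant d I := by
  apply le_antisymm
  · rw [Ideal.span_le]
    rintro _ ⟨i, rfl⟩
    exact Ideal.subset_span ⟨d i, hd i, MvPolynomial.X i,
      MvPolynomial.isWeightedHomogeneous_X R₀ d i, rfl⟩
  · rw [irrelevant, Ideal.span_le]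
    rintro _ ⟨n, hn, f, hf, rfl⟩
    have hf' : MvPolynomial.IsWeightedHomogeneous d f n := hf
    change Ideal.Quotient.mk I f ∈ Ideal.span (Set.range (gen I))
    rw [f.as_sum, map_sum]
    refine Ideal.sum_mem _ fun m hm => ?_
    have hw := hf' (MvPolynomial.mem_support_iff.1 hm)
    obtain ⟨i, hi⟩ : ∃ i, m i ≠ 0 := by
      by_contra hcon
      push Not at hcon
      have : m = 0 := Finsupp.ext hcon
      subst this
      simp at hw
      omega
    have : MvPolynomial.X i ∣ MvPolynomial.monomial m (MvPolynomial.coeff m f) :=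
      MvPolynomial.X_dvd_monomial.2 (Or.inr hi)
    exact Ideal.mem_of_dvd _ (map_dvd _ this) (Ideal.subset_span ⟨i, rfl⟩)

/-- The `R₀`-module `H^s_{R_+}(R)_n`, for `R = R₀[U_1, …, U_s] / I` with `deg U_i = d i`. -/
def topH (d : Fin s → ℕ) (I : Ideal (MvPolynomial (Fin s) R₀)) (n : ℤ) :
    Submodule R₀ (GradedCech.H (gen I) s) :=
  GradedCech.HDegree (grading d I) (gen I) d s n

/-- The set `𝒟` of all `λ_1 d_1 + ⋯ + λ_s d_s` with integers `λ_i ≥ 1`. -/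
def degreeSet (d : Fin s → ℕ) : Set ℕ :=
  {n | ∃ l : Fin s → ℕ, (∀ i, 0 < l i) ∧ ∑ i, l i * d i = n}

/-- A family of homogeneous components `T_n` (`n ∈ ℤ`) is asymptotically gap-free if either
`T_n = 0` for all `n ≪ 0` or `T_n ≠ 0` for all `n ≪ 0`. -/
def AsymptoticallyGapFree {M : Type*} [AddCommGroup M] [Module R₀ M]
    (T : ℤ → Submodule R₀ M) : Prop :=
  (∃ n₀ : ℤ, ∀ n ≤ n₀, T n = ⊥) ∨ (∃ n₀ : ℤ, ∀ n ≤ n₀, T n ≠ ⊥)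

end TopLocalCohomology

end

/-! In top degree the Čech cohomology is `A_{x_1 ⋯ x_s}` modulo the images of the localizations
omitting one variable. Hence `H^s(R)_n` is spanned over `R₀` by the classes of the finitely many
inverse monomials `x^{-l}` of degree `n` with all `l i > 0` (`topH_eq_bot_iff`).

If the content is `R₀`, every maximal ideal `m` misses a coefficient of some generator `f_j`. Let
`a` be the lex-least exponent of such a coefficient. Multiplying `f_j = 0` by `x^{-(a+l)}` writes a
unit mod `m` times `x^{-l}` as a combination of lex-smaller inverse monomials plus an element of `m
• N`, where `N` is the span. Induction gives `N = m • N` (`mkQ_invMon_mem_smul`), and Nakayama at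
every `m` gives `N = 0`.

If the content lies in a maximal ideal `m`, then `R` maps onto `(R₀/m)[U]`, where no `U^{-l}` with
positive exponents is a coboundary (`invMon_notMem_topBoundaries`). Such monomials exist exactly in
the degrees `-𝒟`, and `𝒟` contains all large multiples of the gcd; this yields both the equivalence
and gap-freeness. -/

noncomputable section

namespace GradedCech

variable {k A : Type*} [CommRing k] [CommRing A] [Algebra k A] {s : ℕ}

/-! ### Top Čech cohomology as a quotient of a single localization. -/

/-- The coboundaries of top degree, as a submodule of `A_{x_1 ⋯ x_s}`. -/
def topBoundaries (x : Fin s → A) : Submodule A (Loc x Finset.univ) :=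
  ⨆ i : Fin s, LinearMap.range (res x (Finset.subset_univ (Finset.univ.erase i))).toLinearMap

theorem res_mem_topBoundaries (x : Fin s → A) (i : Fin s) (z : Loc x (Finset.univ.erase i)) :
    res x (Finset.subset_univ _) z ∈ topBoundaries x :=
  Submodule.mem_iSup_of_mem i ⟨z, rfl⟩

/-- The only index of the top term of the Čech complex. -/
def topIndex (s : ℕ) : {σ : Finset (Fin s) // σ.card = s} := ⟨Finset.univ, by simp⟩

theorem eq_topIndex (σ : {σ : Finset (Fin s) // σ.card = s}) : σ = topIndex s :=
  Subtype.ext ((Finset.card_eq_iff_eq_univ _).1 (by simpa using σ.2))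

theorem delta_top (x : Fin s → A) (c : Cochain x s) : delta x s c = 0 := by
  funext τ
  have h := Finset.card_le_univ τ.1
  rw [τ.2] at h
  simp at h

/-- The top term has one component, and the signs in the differential do not change the sum of the
images. For `s = 0` both sides are zero: the supremum is empty. -/
theorem mem_coboundaries_top (x : Fin s → A) (c : Cochain x s) :
    c ∈ coboundaries x s ↔ c (topIndex s) ∈ topBoundaries x := by
  cases s with
  | zero =>
    have h : topBoundaries x = ⊥ := by simp [topBoundaries]
    have h' : c (topIndex 0) ∈ topBoundaries x ↔ c (topIndex 0) = 0 := by
      rw [h]; exact Iff.rfl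
    rw [h', coboundaries, Submodule.mem_bot]
    constructor
    · rintro rfl; rfl
    · intro h
      funext σ
      obtain rfl := eq_topIndex σ
      exact h
  | succ t =>
    have happ (b : Cochain x t) : delta x t b (topIndex (t + 1)) =
        ∑ i : {i // i ∈ (topIndex (t + 1)).1}, sgn (topIndex (t + 1)).1 i.1 •
          res x (face_subset (topIndex (t + 1)) i) (b (face (topIndex (t + 1)) i)) := by
      simp [delta]
    have hface (i : {i // i ∈ (topIndex (t + 1)).1}) (z : Loc x (face (topIndex (t + 1)) i).1) :
        res x (face_subset (topIndex (t + 1)) i) z ∈ topBoundaries x :=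
      res_mem_topBoundaries x i.1 z
    constructor
    · rintro ⟨b, rfl⟩
      rw [happ]
      exact Submodule.sum_mem _ fun i _ => zsmul_mem (hface i _) _
    · intro h
      have hle : topBoundaries x ≤
          (coboundaries x (t + 1)).map (LinearMap.proj (topIndex (t + 1))) := by
        refine iSup_le fun i => ?_
        rintro _ ⟨z, rfl⟩
        let j : {i // i ∈ (topIndex (t + 1)).1} := ⟨i, Finset.mem_univ i⟩
        have hinj : Function.Injective (face (topIndex (t + 1))) := by
          intro a b hab
          by_contra hne
          have h1 : (face (topIndex (t + 1)) a).1 = (face (topIndex (t + 1)) b).1 :=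
            congrArg Subtype.val hab
          have h2 : a.1 ∈ (face (topIndex (t + 1)) b).1 :=
            Finset.mem_erase.2 ⟨fun h => hne (Subtype.ext h), a.2⟩
          rw [← h1] at h2
          exact (Finset.mem_erase.1 h2).1 rfl
        -- Distinct vertices have distinct opposite faces, so only the `j`-th summand of the
        -- differential survives.
        let b : Cochain x t := Pi.single (face (topIndex (t + 1)) j) z
        have hb : delta x t b (topIndex (t + 1)) = sgn (topIndex (t + 1)).1 j.1 •
            res x (face_subset (topIndex (t + 1)) j) z := by
          rw [happ, Finset.sum_eq_single j]
          · rw [show b (face (topIndex (t + 1)) j) = z from Pi.single_eq_same _ _]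
          · intro i _ hi
            rw [show b (face (topIndex (t + 1)) i) = 0 from
              Pi.single_eq_of_ne (fun h => hi (hinj h)) _, map_zero]
            exact zsmul_zero _
          · simp
        rcases neg_one_pow_eq_or ℤ (((topIndex (t + 1)).1.filter (· < j.1)).card) with h1 | h1
        · rw [sgn, h1, one_smul] at hb
          exact ⟨delta x t b, ⟨_, rfl⟩, hb⟩
        · rw [sgn, h1, neg_one_zsmul] at hb
          refine ⟨-delta x t b, neg_mem ⟨_, rfl⟩, ?_⟩
          rw [map_neg, LinearMap.proj_apply, hb, neg_neg]
          rfl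
      obtain ⟨b, hb, hbc⟩ := hle h
      have : c = b := by
        funext σ
        obtain rfl := eq_topIndex σ
        exact hbc.symm
      rwa [this]

theorem HDegree_top_eq_bot_iff (𝒜 : ℕ → Submodule k A) (x : Fin s → A) (d : Fin s → ℕ) (n : ℤ) :
    HDegree 𝒜 x d s n = ⊥ ↔
      ∀ z ∈ locDegree 𝒜 x d Finset.univ n, z ∈ topBoundaries x := by
  rw [HDegree, eq_bot_iff, Submodule.map_le_iff_le_comap]
  constructor
  · intro h z hz
    -- Each index equals `univ` only propositionally, so `res` transports `z` along the equality.
    let c : Cochain x s := fun σ => res x (by rw [eq_topIndex σ]; rfl) z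
    have hcz : c (topIndex s) = z := by
      change res x _ z = z
      have : res x (le_refl Finset.univ) = AlgHom.id A (Loc x Finset.univ) := by
        apply AlgHom.coe_ringHom_injective
        apply IsLocalization.ringHom_ext (Submonoid.powers (xProd x Finset.univ))
        ext a
        simp
      exact DFunLike.congr_fun this z
    have hc (σ) (hσ : σ = topIndex s) : c σ ∈ locDegree 𝒜 x d σ.1 n := by
      subst hσ
      rwa [hcz]
    have h1 : (⟨c, delta_top x c⟩ : LinearMap.ker (delta x s)) ∈
        (cochainDegree 𝒜 x d s n).comap
          ((LinearMap.ker (delta x s)).subtype.restrictScalars k) := by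
      intro σ _
      exact hc σ (eq_topIndex σ)
    have h2 := h h1
    have h3 : c ∈ coboundaries x s := by
      have h3 : (⟨c, delta_top x c⟩ : LinearMap.ker (delta x s)) ∈
          (coboundaries x s).submoduleOf (LinearMap.ker (delta x s)) :=
        (Submodule.Quotient.mk_eq_zero _).1 (LinearMap.mem_ker.1 h2)
      exact h3
    rw [← hcz]
    exact (mem_coboundaries_top x c).1 h3
  · rintro h ⟨c, hc⟩ hcd
    refine LinearMap.mem_ker.2 ((Submodule.Quotient.mk_eq_zero _).2 ?_)
    exact (mem_coboundaries_top x c).2 (h _ (hcd (topIndex s) trivial))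

/-! ### Inverse monomials. -/

/-- The inverse of `x i` in `A_{x_σ}` (meaningful for `i ∈ σ`). -/
def invVar (x : Fin s → A) (σ : Finset (Fin s)) (i : Fin s) : Loc x σ :=
  Ring.inverse (algebraMap A (Loc x σ) (x i))

theorem algebraMap_mul_invVar (x : Fin s → A) {σ : Finset (Fin s)} {i : Fin s} (hi : i ∈ σ) :
    algebraMap A (Loc x σ) (x i) * invVar x σ i = 1 :=
  Ring.mul_inverse_cancel _ (isUnit_of_dvd_unit (map_dvd _ (Finset.dvd_prod_of_mem x hi))
    (IsLocalization.Away.algebraMap_isUnit (xProd x σ)))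

theorem res_invVar (x : Fin s → A) {σ τ : Finset (Fin s)} (h : σ ⊆ τ) {i : Fin s} (hi : i ∈ σ) :
    res x h (invVar x σ i) = invVar x τ i := by
  have h1 := congrArg (res x h) (algebraMap_mul_invVar x hi)
  rw [map_mul, AlgHom.commutes, map_one] at h1
  have h2 := algebraMap_mul_invVar x (h hi)
  linear_combination (-res x h (invVar x σ i)) * h2 + invVar x τ i * h1

/-- The inverse monomial `∏ i, x i ^ (-l i)` in `A_{x_1 ⋯ x_s}`. -/
def invMon (x : Fin s → A) (l : Fin s →₀ ℕ) : Loc x Finset.univ :=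
  ∏ i, invVar x Finset.univ i ^ l i

theorem invMon_add (x : Fin s → A) (l m : Fin s →₀ ℕ) :
    invMon x (l + m) = invMon x l * invMon x m := by
  simp [invMon, pow_add, Finset.prod_mul_distrib]

theorem mon_mul_invMon (x : Fin s → A) (a : Fin s →₀ ℕ) :
    algebraMap A (Loc x Finset.univ) (∏ i, x i ^ a i) * invMon x a = 1 := by
  rw [invMon, map_prod, ← Finset.prod_mul_distrib]
  refine Finset.prod_eq_one fun i _ => ?_
  rw [map_pow, ← mul_pow, algebraMap_mul_invVar x (Finset.mem_univ i), one_pow]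

theorem mon_mul_invMon_add (x : Fin s → A) (a l : Fin s →₀ ℕ) :
    algebraMap A (Loc x Finset.univ) (∏ i, x i ^ a i) * invMon x (a + l) = invMon x l := by
  rw [invMon_add, ← mul_assoc, mon_mul_invMon, one_mul]

/-- Once `x i` has cancelled from the denominator, the fraction already lives in the localization at
the other variables. -/
theorem mon_mul_invMon_mem_topBoundaries (x : Fin s → A) (a l : Fin s →₀ ℕ) (i : Fin s)
    (hi : l i ≤ a i) :
    algebraMap A (Loc x Finset.univ) (∏ i, x i ^ a i) * invMon x l ∈ topBoundaries x := by
  have key : algebraMap A (Loc x Finset.univ) (∏ i, x i ^ a i) * invMon x l =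
      algebraMap A (Loc x Finset.univ) (x i ^ (a i - l i) * ∏ j ∈ Finset.univ.erase i, x j ^ a j) *
        res x (Finset.subset_univ (Finset.univ.erase i))
          (∏ j ∈ Finset.univ.erase i, invVar x (Finset.univ.erase i) j ^ l j) := by
    have h1 : res x (Finset.subset_univ (Finset.univ.erase i))
          (∏ j ∈ Finset.univ.erase i, invVar x (Finset.univ.erase i) j ^ l j) =
          ∏ j ∈ Finset.univ.erase i, invVar x Finset.univ j ^ l j := by
      rw [map_prod]
      refine Finset.prod_congr rfl fun j hj => ?_
      rw [map_pow, res_invVar x _ hj]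
    rw [h1, invMon, ← Finset.mul_prod_erase _ _ (Finset.mem_univ i),
      ← Finset.mul_prod_erase Finset.univ (fun j => invVar x Finset.univ j ^ l j)
        (Finset.mem_univ i)]
    have h2 : algebraMap A (Loc x Finset.univ) (x i) ^ (l i) * invVar x Finset.univ i ^ l i = 1 := by
      rw [← mul_pow, algebraMap_mul_invVar x (Finset.mem_univ i), one_pow]
    obtain ⟨e, he⟩ := Nat.exists_eq_add_of_le hi
    rw [he, Nat.add_sub_cancel_left, pow_add]
    simp only [map_mul, map_pow]
    linear_combination (algebraMap A (Loc x Finset.univ) (x i) ^ e *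
      algebraMap A (Loc x Finset.univ) (∏ j ∈ Finset.univ.erase i, x j ^ a j) *
      ∏ j ∈ Finset.univ.erase i, invVar x Finset.univ j ^ l j) * h2
  rw [key, ← Algebra.smul_def]
  exact Submodule.smul_mem _ _ (res_mem_topBoundaries x i _)

/-- The constant multi-exponent. -/
def constExp (s j : ℕ) : Fin s →₀ ℕ := Finsupp.equivFunOnFinite.symm fun _ => j

theorem mk_pow_eq (x : Fin s → A) (a : A) (j : ℕ) :
    Localization.mk a (⟨xProd x Finset.univ ^ j, j, rfl⟩ :
      Submonoid.powers (xProd x Finset.univ)) =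
    algebraMap A (Loc x Finset.univ) a * invMon x (constExp s j) := by
  rw [Localization.mk_eq_mk', IsLocalization.mk'_eq_iff_eq_mul]
  have h := mon_mul_invMon x (constExp s j)
  simp only [constExp, Finsupp.equivFunOnFinite_symm_apply_apply, Finset.prod_pow] at h ⊢
  change _ = _ * algebraMap A (Loc x Finset.univ) ((∏ i, x i) ^ j)
  linear_combination (-algebraMap A (Loc x Finset.univ) a) * h

end GradedCech
end

noncomputable section

namespace TopLocalCohomology

open GradedCech

variable {R₀ : Type*} [CommRing R₀] {s : ℕ}

/-! ### Graded pieces of the top cohomology of `R₀[U] / I`. -/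

theorem prod_gen_pow (I : Ideal (MvPolynomial (Fin s) R₀)) (a : Fin s →₀ ℕ) :
    ∏ i, gen I i ^ a i = Ideal.Quotient.mk I (MvPolynomial.monomial a 1) := by
  rw [MvPolynomial.monomial_eq, Finsupp.prod_fintype _ _ (by simp)]
  simp [gen]

theorem mk_eq_sum (I : Ideal (MvPolynomial (Fin s) R₀)) (f : MvPolynomial (Fin s) R₀) :
    Ideal.Quotient.mk I f =
      ∑ a ∈ f.support, MvPolynomial.coeff a f • ∏ i, gen I i ^ a i := by
  conv_lhs => rw [f.as_sum, map_sum]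
  refine Finset.sum_congr rfl fun a _ => ?_
  rw [prod_gen_pow]
  change _ = MvPolynomial.coeff a f • (Ideal.Quotient.mkₐ R₀ I) _
  rw [← map_smul, MvPolynomial.smul_monomial, smul_eq_mul, mul_one]
  rfl

theorem weight_eq_sum (d : Fin s → ℕ) (a : Fin s →₀ ℕ) :
    Finsupp.weight d a = ∑ i, a i * d i := by
  rw [Finsupp.weight_apply, Finsupp.sum_fintype _ _ (by simp)]
  simp

theorem algebraMap_mk_mul (I : Ideal (MvPolynomial (Fin s) R₀)) (f : MvPolynomial (Fin s) R₀)
    (z : Loc (gen I) Finset.univ) :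
    algebraMap _ (Loc (gen I) Finset.univ) (Ideal.Quotient.mk I f) * z =
      ∑ a ∈ f.support, MvPolynomial.coeff a f •
        (algebraMap _ (Loc (gen I) Finset.univ) (∏ i, gen I i ^ a i) * z) := by
  rw [mk_eq_sum, map_sum, Finset.sum_mul]
  refine Finset.sum_congr rfl fun a _ => ?_
  rw [Algebra.algebraMap_eq_smul_one, smul_assoc, smul_mul_assoc, ← Algebra.algebraMap_eq_smul_one]

/-- `H^s_{R_+}(R)_n` vanishes if and only if all inverse monomials of degree `n` with negative
exponents are coboundaries. -/
theorem topH_eq_bot_iff (d : Fin s → ℕ) (I : Ideal (MvPolynomial (Fin s) R₀)) (n : ℤ) :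
    topH d I n = ⊥ ↔ ∀ l : Fin s →₀ ℕ, (∀ i, 0 < l i) → (Finsupp.weight d l : ℤ) = -n →
      invMon (gen I) l ∈ topBoundaries (gen I) := by
  rw [topH, HDegree_top_eq_bot_iff]
  constructor
  · intro h l _ hl
    refine h _ (Submodule.subset_span ?_)
    -- `locDegree` only allows powers of the full product as denominators; the sum of the `l j` is a
    -- common exponent dominating each of them.
    have hle : ∀ i, l i ≤ ∑ j, l j := fun i =>
      Finset.single_le_sum (f := fun j => l j) (fun _ _ => Nat.zero_le _) (Finset.mem_univ i)
    obtain ⟨a, ha⟩ : ∃ a : Fin s →₀ ℕ, a + l = constExp s (∑ j, l j) :=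
      ⟨constExp s (∑ j, l j) - l, tsub_add_cancel_of_le fun i => by simpa [constExp] using hle i⟩
    refine ⟨Finsupp.weight d a, ∑ j, l j, ∏ i, gen I i ^ a i, ?_, ?_, ?_⟩
    · rw [prod_gen_pow]
      exact ⟨_, MvPolynomial.isWeightedHomogeneous_monomial d a 1 rfl, rfl⟩
    · have h1 := congrArg (Finsupp.weight d) ha
      rw [map_add] at h1
      have h2 : Finsupp.weight d (constExp s (∑ j, l j)) = (∑ j, l j) * ∑ i, d i := by
        rw [weight_eq_sum, Finset.mul_sum]
        rfl
      rw [h2] at h1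
      have h3 := congrArg (Nat.cast : ℕ → ℤ) h1
      push_cast at h3 ⊢
      linarith
    · rw [mk_pow_eq, ← ha, mon_mul_invMon_add]
  · intro h z hz
    refine Submodule.span_le (p := (topBoundaries (gen I)).restrictScalars R₀).2 ?_ hz
    rintro _ ⟨m, j, _, ⟨f, hf, rfl⟩, hm, rfl⟩
    have hf' : MvPolynomial.IsWeightedHomogeneous d f m := hf
    rw [mk_pow_eq]
    change algebraMap _ _ (Ideal.Quotient.mk I f) * _ ∈ (topBoundaries (gen I)).restrictScalars R₀
    rw [algebraMap_mk_mul]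
    refine Submodule.sum_mem _ fun a ha => Submodule.smul_mem _ _ ?_
    rw [Submodule.restrictScalars_mem]
    by_cases hj : ∃ i, j ≤ a i
    · obtain ⟨i, hi⟩ := hj
      exact mon_mul_invMon_mem_topBoundaries _ a _ i hi
    · push Not at hj
      obtain ⟨l, hl⟩ : ∃ l : Fin s →₀ ℕ, a + l = constExp s j :=
        ⟨constExp s j - a, add_tsub_cancel_of_le fun i => by simpa [constExp] using (hj i).le⟩
      rw [← hl, mon_mul_invMon_add]
      refine h l (fun i => ?_) ?_
      · have h1 := DFunLike.congr_fun hl i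
        have h2 := hj i
        simp only [Finsupp.add_apply, constExp, Finsupp.equivFunOnFinite_symm_apply_apply] at h1
        omega
      · have h1 := congrArg (Finsupp.weight d) hl
        have h2 : Finsupp.weight d (constExp s j) = j * ∑ i, d i := by
          rw [weight_eq_sum, Finset.mul_sum]
          rfl
        rw [map_add, hf' (MvPolynomial.mem_support_iff.1 ha), h2] at h1
        have h3 := congrArg (Nat.cast : ℕ → ℤ) h1
        push_cast at h3
        linarith

/-! ### Vanishing when the content is the unit ideal. -/

theorem finite_setOf_weight_eq (d : Fin s → ℕ) (hd : ∀ i, 0 < d i) (n : ℤ) :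
    {l : Fin s →₀ ℕ | (Finsupp.weight d l : ℤ) = n}.Finite := by
  refine (Set.finite_Iic (constExp s n.toNat)).subset fun l hl i => ?_
  simp only [constExp, Finsupp.equivFunOnFinite_symm_apply_apply]
  rw [Set.mem_ofPred_eq, weight_eq_sum] at hl
  have h1 : l i * d i ≤ ∑ j, l j * d j :=
    Finset.single_le_sum (f := fun j => l j * d j) (fun _ _ => Nat.zero_le _) (Finset.mem_univ i)
  have h2 : l i ≤ l i * d i := Nat.le_mul_of_pos_right _ (hd i)
  omega

/-- Polynomials with all coefficients in `m` form an ideal; if it contained the generators it would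
contain `I`, forcing the content into `m`. -/
theorem exists_coeff_notMem (I : Ideal (MvPolynomial (Fin s) R₀)) {r : ℕ}
    (f : Fin r → MvPolynomial (Fin s) R₀) (hI : I = Ideal.span (Set.range f))
    (hc : content I = ⊤) (m : Ideal R₀) (hm : m ≠ ⊤) :
    ∃ j a, MvPolynomial.coeff a (f j) ∉ m := by
  by_contra! hcon
  have hle : I ≤ m.map MvPolynomial.C := by
    rw [hI, Ideal.span_le]
    rintro _ ⟨j, rfl⟩
    exact MvPolynomial.mem_map_C_iff.2 (hcon j)
  refine hm (top_unique (hc ▸ Ideal.span_le.2 ?_))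
  rintro _ ⟨g, hg, a, rfl⟩
  exact MvPolynomial.mem_map_C_iff.1 (hle hg) a

theorem _root_.Ideal.IsMaximal.mem_smul_of_smul_mem_smul {M : Type*} [AddCommGroup M] [Module R₀ M]
    {m : Ideal R₀} (hm : m.IsMaximal) {N : Submodule R₀ M} {a : R₀} (ha : a ∉ m) {v : M}
    (hv : v ∈ N) (hav : a • v ∈ m • N) : v ∈ m • N := by
  obtain ⟨c, t, ht, hct⟩ := hm.exists_inv ha
  have h : v = c • (a • v) + t • v := by
    rw [smul_smul, ← add_smul, hct, one_smul]
  rw [h]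
  exact add_mem (Submodule.smul_mem _ _ hav) (Submodule.smul_mem_smul ht hv)

/-- Modulo coboundaries and modulo a maximal ideal `m`, the inverse monomials of a fixed degree
are annihilated by a homogeneous polynomial with a coefficient outside `m`, hence zero. -/
theorem mkQ_invMon_mem_smul (d : Fin s → ℕ) (I : Ideal (MvPolynomial (Fin s) R₀)) (n : ℤ)
    (f : MvPolynomial (Fin s) R₀) (hfI : f ∈ I) {e : ℕ}
    (hf : MvPolynomial.IsWeightedHomogeneous d f e) (m : Ideal R₀) (hm : m.IsMaximal)
    (hfm : ∃ a, MvPolynomial.coeff a f ∉ m)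
    (l : Fin s →₀ ℕ) (hl : (Finsupp.weight d l : ℤ) = n) :
    (topBoundaries (gen I)).mkQ (invMon (gen I) l) ∈
      m • Submodule.span R₀ ((fun l => (topBoundaries (gen I)).mkQ (invMon (gen I) l)) ''
        {l : Fin s →₀ ℕ | (Finsupp.weight d l : ℤ) = n}) := by
  classical
  set N := Submodule.span R₀ ((fun l => (topBoundaries (gen I)).mkQ (invMon (gen I) l)) ''
        {l : Fin s →₀ ℕ | (Finsupp.weight d l : ℤ) = n}) with hN
  -- The proof uses only that this is a well-order compatible with addition: it provides the least
  -- exponent `a` and the induction on `l`.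
  let o : MonomialOrder (Fin s) := MonomialOrder.lex
  obtain ⟨a, ha, hmin⟩ : ∃ a, MvPolynomial.coeff a f ∉ m ∧
      ∀ b, MvPolynomial.coeff b f ∉ m → o.toSyn a ≤ o.toSyn b := by
    let p : Set o.syn := {z | MvPolynomial.coeff (o.toSyn.symm z) f ∉ m}
    obtain ⟨b, hb⟩ := hfm
    have hp : p.Nonempty := ⟨o.toSyn b, by simpa [p] using hb⟩
    refine ⟨o.toSyn.symm (wellFounded_lt.min p hp), wellFounded_lt.min_mem p hp, fun c hc => ?_⟩
    rw [AddEquiv.apply_symm_apply]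
    exact wellFounded_lt.min_le (by simpa [p] using hc)
  have hwa : Finsupp.weight d a = e := hf (fun h => ha (by rw [h]; exact m.zero_mem))
  suffices key : ∀ (w : o.syn) (l : Fin s →₀ ℕ), (Finsupp.weight d l : ℤ) = n → o.toSyn l = w →
      (topBoundaries (gen I)).mkQ (invMon (gen I) l) ∈ m • N from key _ l hl rfl
  clear hl l
  intro w
  induction w using WellFoundedLT.induction with
  | ind w ih =>
  rintro l hl rfl
  -- The shift by `a + l` turns the term of exponent `a` into `x^{-l}` itself.
  have hsum : ∑ b ∈ f.support, MvPolynomial.coeff b f • (topBoundaries (gen I)).mkQ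
      (algebraMap _ (Loc (gen I) Finset.univ) (∏ i, gen I i ^ b i) *
        invMon (gen I) (a + l)) = 0 := by
    have h1 := algebraMap_mk_mul I f (invMon (gen I) (a + l))
    rw [Ideal.Quotient.eq_zero_iff_mem.2 hfI, map_zero, zero_mul] at h1
    have h2 := congrArg ((topBoundaries (gen I)).mkQ.restrictScalars R₀) h1
    rw [map_zero, map_sum] at h2
    rw [h2]
    exact Finset.sum_congr rfl fun b _ => (map_smul
      ((topBoundaries (gen I)).mkQ.restrictScalars R₀) _ _).symm
  rw [← Finset.add_sum_erase _ _ (MvPolynomial.mem_support_iff.2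
    (fun h => ha (by rw [h]; exact m.zero_mem))), mon_mul_invMon_add] at hsum
  have hrest : ∑ b ∈ f.support.erase a, MvPolynomial.coeff b f • (topBoundaries (gen I)).mkQ
      (algebraMap _ (Loc (gen I) Finset.univ) (∏ i, gen I i ^ b i) *
        invMon (gen I) (a + l)) ∈ m • N := by
    refine Submodule.sum_mem _ fun b hb => ?_
    obtain ⟨hba, hbs⟩ := Finset.mem_erase.1 hb
    by_cases hle : ∃ i, a i + l i ≤ b i
    · obtain ⟨i, hi⟩ := hle
      have h0 : (topBoundaries (gen I)).mkQ (algebraMap _ (Loc (gen I) Finset.univ)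
          (∏ i, gen I i ^ b i) * invMon (gen I) (a + l)) = 0 :=
        (Submodule.Quotient.mk_eq_zero _).2
          (mon_mul_invMon_mem_topBoundaries (gen I) b (a + l) i hi)
      rw [h0, smul_zero]
      exact Submodule.zero_mem _
    · push Not at hle
      obtain ⟨l', hl'⟩ : ∃ l', a + l = b + l' :=
        ⟨a + l - b, (add_tsub_cancel_of_le fun i => (hle i).le).symm⟩
      have hwl : (Finsupp.weight d l' : ℤ) = n := by
        have h1 := congrArg (Finsupp.weight d) hl'
        rw [map_add, map_add, hwa, hf (MvPolynomial.mem_support_iff.1 hbs)] at h1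
        omega
      rw [hl', mon_mul_invMon_add]
      by_cases hbm : MvPolynomial.coeff b f ∈ m
      · exact Submodule.smul_mem_smul hbm (Submodule.subset_span ⟨l', hwl, rfl⟩)
      · refine Submodule.smul_mem _ _ (ih (o.toSyn l') ?_ l' hwl rfl)
        -- From `a + l = b + l'` and `a < b` follows `l' < l`, so the induction hypothesis applies.
        have h1 : o.toSyn a < o.toSyn b :=
          lt_of_le_of_ne (hmin b hbm) fun h => hba (o.toSyn.injective h).symm
        have h2 := congrArg o.toSyn hl'
        rw [map_add, map_add] at h2
        by_contra! hcon
        exact (add_lt_add_of_lt_of_le h1 hcon).ne h2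
  have hal : MvPolynomial.coeff a f • (topBoundaries (gen I)).mkQ (invMon (gen I) l) ∈ m • N := by
    rw [eq_neg_of_add_eq_zero_left hsum]
    exact neg_mem hrest
  exact hm.mem_smul_of_smul_mem_smul ha (Submodule.subset_span ⟨l, hl, rfl⟩) hal

theorem topH_eq_bot_of_content_eq_top (d : Fin s → ℕ) (hd : ∀ i, 0 < d i)
    (I : Ideal (MvPolynomial (Fin s) R₀)) {r : ℕ} (f : Fin r → MvPolynomial (Fin s) R₀)
    (e : Fin r → ℕ) (hf : ∀ j, MvPolynomial.IsWeightedHomogeneous d (f j) (e j))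
    (hI : I = Ideal.span (Set.range f)) (hc : content I = ⊤) (n : ℤ) : topH d I n = ⊥ := by
  rw [topH_eq_bot_iff]
  intro l _ hl
  set N := Submodule.span R₀ ((fun l => (topBoundaries (gen I)).mkQ (invMon (gen I) l)) ''
        {l : Fin s →₀ ℕ | (Finsupp.weight d l : ℤ) = -n}) with hN
  have hfg : N.FG := Submodule.fg_span ((finite_setOf_weight_eq d hd (-n)).image _)
  -- A maximal ideal `m` over the annihilator would give `N = m • N`; Nakayama then produces an
  -- annihilating element congruent to `1` mod `m`, a contradiction.
  have hann : N.annihilator = ⊤ := by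
    by_contra hne
    obtain ⟨m, hm, hle⟩ := Ideal.exists_le_maximal _ hne
    obtain ⟨j, hj⟩ := exists_coeff_notMem I f hI hc m hm.ne_top
    have hsm : N ≤ m • N := by
      refine Submodule.span_le.2 ?_
      rintro _ ⟨l, hl, rfl⟩
      exact mkQ_invMon_mem_smul d I (-n) (f j) (hI ▸ Ideal.subset_span ⟨j, rfl⟩) (hf j) m hm hj l hl
    obtain ⟨r, hr, hrN⟩ :=
      Submodule.exists_sub_one_mem_and_smul_eq_zero_of_fg_of_le_smul m N hfg hsm
    refine hm.ne_top ((Ideal.eq_top_iff_one _).2 ?_)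
    have := sub_mem (hle (Submodule.mem_annihilator.2 hrN)) hr
    simpa using this
  have h0 : N = ⊥ := Submodule.annihilator_eq_top_iff.1 hann
  have h1 : (topBoundaries (gen I)).mkQ (invMon (gen I) l) ∈ N := Submodule.subset_span ⟨l, hl, rfl⟩
  rw [h0, Submodule.mem_bot] at h1
  exact (Submodule.Quotient.mk_eq_zero _).1 h1

end TopLocalCohomology
end

noncomputable section

namespace TopLocalCohomology

open GradedCech

variable {R₀ : Type*} [CommRing R₀] {s : ℕ}

/-! ### Nonvanishing when the content is proper. -/

/-- For every coboundary `y` of top degree, `(x_1 ⋯ x_s) ^ n * y` comes from the ideal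
`(x_1 ^ n, …, x_s ^ n)` for all large `n`. -/
theorem exists_pow_mul_eq_of_mem_topBoundaries {A : Type*} [CommRing A] (x : Fin s → A)
    (y : Loc x Finset.univ) (hy : y ∈ topBoundaries x) :
    ∃ n₀ : ℕ, ∀ n ≥ n₀, ∃ q ∈ Ideal.span (Set.range fun i => x i ^ n),
      algebraMap A (Loc x Finset.univ) (xProd x Finset.univ ^ n) * y =
        algebraMap A (Loc x Finset.univ) q := by
  refine Submodule.iSup_induction _ (motive := fun y => ∃ n₀ : ℕ, ∀ n ≥ n₀,
    ∃ q ∈ Ideal.span (Set.range fun i => x i ^ n),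
      algebraMap A (Loc x Finset.univ) (xProd x Finset.univ ^ n) * y =
        algebraMap A (Loc x Finset.univ) q) hy ?_ ?_ ?_
  · rintro i _ ⟨z, rfl⟩
    obtain ⟨j, a, ha⟩ := IsLocalization.Away.surj (xProd x (Finset.univ.erase i)) z
    refine ⟨j, fun n hn => ⟨xProd x (Finset.univ.erase i) ^ (n - j) * a * x i ^ n,
      Ideal.mul_mem_left _ _ (Ideal.subset_span ⟨i, rfl⟩), ?_⟩⟩
    have h1 := congrArg (res x (Finset.subset_univ (Finset.univ.erase i))) ha
    rw [map_mul, map_pow, AlgHom.commutes, AlgHom.commutes] at h1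
    obtain ⟨t, rfl⟩ := Nat.exists_eq_add_of_le hn
    have h2 : xProd x Finset.univ = x i * xProd x (Finset.univ.erase i) :=
      (Finset.mul_prod_erase _ _ (Finset.mem_univ i)).symm
    have h3 := congrArg (fun b => algebraMap A (Loc x Finset.univ) b ^ (j + t)) h2
    rw [Nat.add_sub_cancel_left, AlgHom.toLinearMap_apply, map_pow, h3]
    simp only [map_mul, map_pow, ← h1]
    ring
  · exact ⟨0, fun n _ => ⟨0, Submodule.zero_mem _, by simp⟩⟩
  · rintro y z ⟨n₁, h₁⟩ ⟨n₂, h₂⟩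
    refine ⟨max n₁ n₂, fun n hn => ?_⟩
    obtain ⟨p, hp, hpy⟩ := h₁ n (le_trans (le_max_left _ _) hn)
    obtain ⟨q, hq, hqz⟩ := h₂ n (le_trans (le_max_right _ _) hn)
    exact ⟨p + q, add_mem hp hq, by rw [mul_add, hpy, hqz, map_add]⟩

theorem coeff_eq_zero_of_mem_span_pow {K : Type*} [CommRing K] (n : ℕ)
    (g : MvPolynomial (Fin s) K)
    (hg : g ∈ Ideal.span (Set.range fun i : Fin s => (MvPolynomial.X i : MvPolynomial (Fin s) K) ^ n))
    (a : Fin s →₀ ℕ) (ha : ∀ i, a i < n) : MvPolynomial.coeff a g = 0 := by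
  classical
  obtain ⟨c, rfl⟩ := Ideal.mem_span_range_iff_exists_fun.1 hg
  rw [MvPolynomial.coeff_sum]
  refine Finset.sum_eq_zero fun i _ => ?_
  rw [MvPolynomial.X_pow_eq_monomial, MvPolynomial.coeff_mul_monomial', if_neg]
  intro h
  have := h i
  rw [Finsupp.single_eq_same] at this
  exact absurd (ha i) (not_lt.2 this)

/-- Clearing denominators and reducing modulo a maximal ideal over the content would put a monomial
with all exponents below `n` into `(U_1 ^ n, …, U_s ^ n)`. -/
theorem invMon_notMem_topBoundaries (I : Ideal (MvPolynomial (Fin s) R₀)) (hc : content I ≠ ⊤)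
    (l : Fin s →₀ ℕ) (hl : ∀ i, 0 < l i) : invMon (gen I) l ∉ topBoundaries (gen I) := by
  intro hmem
  obtain ⟨m, hm, hle⟩ := Ideal.exists_le_maximal _ hc
  have : IsDomain (R₀ ⧸ m) := Ideal.Quotient.isDomain m
  let φ : MvPolynomial (Fin s) R₀ ⧸ I →+* MvPolynomial (Fin s) (R₀ ⧸ m) :=
    Ideal.Quotient.lift I (MvPolynomial.map (Ideal.Quotient.mk m)) fun f hf => by
      ext a
      rw [MvPolynomial.coeff_map, MvPolynomial.coeff_zero, Ideal.Quotient.eq_zero_iff_mem]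
      exact hle (Ideal.subset_span ⟨f, hf, a, rfl⟩)
  have hφ (i) : φ (gen I i) = MvPolynomial.X i := by simp [φ, gen]
  obtain ⟨n₀, hn₀⟩ := exists_pow_mul_eq_of_mem_topBoundaries _ _ hmem
  let n := n₀ + ∑ j, l j
  obtain ⟨q, hq, hqy⟩ := hn₀ n (Nat.le_add_right _ _)
  have hln : ∀ i, l i ≤ n := fun i =>
    (Finset.single_le_sum (f := fun j => l j) (fun _ _ => Nat.zero_le _)
      (Finset.mem_univ i)).trans (Nat.le_add_left _ _)
  obtain ⟨a, ha⟩ : ∃ a : Fin s →₀ ℕ, l + a = constExp s n :=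
    ⟨constExp s n - l, add_tsub_cancel_of_le fun i => by simpa [constExp] using hln i⟩
  have han : ∀ i, a i < n := fun i => by
    have h1 := DFunLike.congr_fun ha i
    have h2 := hl i
    simp only [Finsupp.add_apply, constExp, Finsupp.equivFunOnFinite_symm_apply_apply] at h1
    omega
  have hpow : xProd (gen I) Finset.univ ^ n = (∏ i, gen I i ^ a i) * ∏ i, gen I i ^ l i := by
    rw [xProd, ← Finset.prod_pow, ← Finset.prod_mul_distrib]
    refine Finset.prod_congr rfl fun i _ => ?_
    have h1 := DFunLike.congr_fun ha i
    simp only [Finsupp.add_apply, constExp, Finsupp.equivFunOnFinite_symm_apply_apply] at h1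
    rw [← pow_add, ← h1, add_comm]
  rw [hpow, map_mul, mul_assoc, mon_mul_invMon, mul_one] at hqy
  obtain ⟨⟨_, t, rfl⟩, ht⟩ :=
    (IsLocalization.eq_iff_exists (Submonoid.powers (xProd (gen I) Finset.univ)) _).1 hqy
  have h1 := congrArg φ ht
  simp only [map_mul, map_pow, map_prod, xProd, hφ] at h1
  -- The variables may be zero divisors in `R`, but over the domain `R₀ ⧸ m` their product can be
  -- cancelled.
  have h0 : (∏ i : Fin s, (MvPolynomial.X i : MvPolynomial (Fin s) (R₀ ⧸ m))) ^ t ≠ 0 :=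
    pow_ne_zero _ (Finset.prod_ne_zero_iff.2 fun i _ => MvPolynomial.X_ne_zero i)
  have h2 := mul_left_cancel₀ h0 h1
  have hφq : φ q ∈ Ideal.span (Set.range fun i : Fin s =>
      (MvPolynomial.X i : MvPolynomial (Fin s) (R₀ ⧸ m)) ^ n) := by
    have := Ideal.mem_map_of_mem φ hq
    rw [Ideal.map_span, ← Set.range_comp] at this
    convert this using 3
    ext1 i
    simp [hφ]
  have h3 := coeff_eq_zero_of_mem_span_pow n _ hφq a han
  have h4 : ∏ i : Fin s, (MvPolynomial.X i : MvPolynomial (Fin s) (R₀ ⧸ m)) ^ a i =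
      MvPolynomial.monomial a 1 := by
    rw [MvPolynomial.monomial_eq, Finsupp.prod_fintype _ _ (by simp)]
    simp
  rw [← h2, h4, MvPolynomial.coeff_monomial, if_pos rfl] at h3
  exact one_ne_zero h3

/-! ### The degree set and gap-freeness. -/

theorem mem_degreeSet_iff (d : Fin s → ℕ) (n : ℕ) :
    n ∈ degreeSet d ↔ ∃ l : Fin s →₀ ℕ, (∀ i, 0 < l i) ∧ Finsupp.weight d l = n := by
  constructor
  · rintro ⟨l, hl, rfl⟩
    exact ⟨Finsupp.equivFunOnFinite.symm l, hl, by rw [weight_eq_sum]; rfl⟩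
  · rintro ⟨l, hl, rfl⟩
    exact ⟨l, hl, (weight_eq_sum d l).symm⟩

theorem topH_ne_bot_of_content_ne_top (d : Fin s → ℕ) (I : Ideal (MvPolynomial (Fin s) R₀))
    (hc : content I ≠ ⊤) {n : ℕ} (hn : n ∈ degreeSet d) : topH d I (-(n : ℤ)) ≠ ⊥ := by
  obtain ⟨l, hl, rfl⟩ := (mem_degreeSet_iff d n).1 hn
  intro h
  exact invMon_notMem_topBoundaries I hc l hl ((topH_eq_bot_iff d I _).1 h l hl (by simp))

/-- The numerical semigroup of the `d i` contains all large multiples of their gcd; adding `∑ i, d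
i` makes every coefficient at least `1`. -/
theorem exists_forall_mem_degreeSet (d : Fin s → ℕ) :
    ∃ n₀ : ℕ, ∀ n ≥ n₀, Finset.univ.gcd d ∣ n → n ∈ degreeSet d := by
  have hg : Nat.setGcd (Set.range d) = Finset.univ.gcd d := by
    refine Nat.dvd_antisymm (Finset.dvd_gcd fun i _ => Nat.setGcd_dvd_of_mem ⟨i, rfl⟩)
      (Nat.dvd_setGcd_iff.2 ?_)
    rintro _ ⟨i, rfl⟩
    exact Finset.gcd_dvd (Finset.mem_univ i)
  obtain ⟨n₁, hn₁⟩ := Nat.exists_mem_closure_of_ge (Set.range d)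
  rw [hg] at hn₁
  refine ⟨n₁ + ∑ i, d i, fun n hn hdvd => ?_⟩
  have hsum : Finset.univ.gcd d ∣ ∑ i, d i := Finset.dvd_sum fun i hi => Finset.gcd_dvd hi
  have hmem := hn₁ (n - ∑ i, d i) (by omega) (Nat.dvd_sub hdvd hsum)
  rw [← Submodule.span_nat_eq_addSubmonoidClosure, Submodule.mem_toAddSubmonoid,
    Submodule.mem_span_range_iff_exists_fun] at hmem
  obtain ⟨c, hc⟩ := hmem
  refine ⟨fun i => c i + 1, fun i => Nat.succ_pos _, ?_⟩
  simp only [smul_eq_mul] at hc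
  simp only [add_mul, one_mul, Finset.sum_add_distrib, hc]
  omega

theorem topH_eq_bot_of_not_dvd (d : Fin s → ℕ) (I : Ideal (MvPolynomial (Fin s) R₀)) (n : ℤ)
    (hn : ¬ ((Finset.univ.gcd d : ℕ) : ℤ) ∣ n) : topH d I n = ⊥ := by
  rw [topH_eq_bot_iff]
  intro l _ hl
  refine absurd ?_ hn
  rw [← dvd_neg, ← hl, Int.natCast_dvd_natCast, weight_eq_sum]
  exact Finset.dvd_sum fun i hi => (Finset.gcd_dvd hi).mul_left _

theorem asymptoticallyGapFree_topH (d : Fin s → ℕ) (hd : ∀ i, 0 < d i)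
    (I : Ideal (MvPolynomial (Fin s) R₀))
    (hI : content I = ⊤ → ∀ n : ℤ, topH d I n = ⊥) :
    AsymptoticallyGapFree (fun n : ℤ => topH d I (((Finset.univ.gcd d : ℕ) : ℤ) * n)) := by
  by_cases hc : content I = ⊤
  · exact Or.inl ⟨0, fun n _ => hI hc _⟩
  · right
    obtain ⟨n₀, hn₀⟩ := exists_forall_mem_degreeSet d
    refine ⟨-(n₀ : ℤ), fun n hn => ?_⟩
    obtain ⟨k, rfl⟩ : ∃ k : ℕ, n = -(k : ℤ) := ⟨n.natAbs, by omega⟩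
    have hmem : Finset.univ.gcd d * k ∈ degreeSet d := by
      -- As the weights are positive, the gcd vanishes only for `s = 0`, where `0` is the empty sum.
      rcases Nat.eq_zero_or_pos (Finset.univ.gcd d) with hg | hg
      · refine ⟨fun _ => 1, fun _ => one_pos, ?_⟩
        rw [hg, zero_mul]
        exact Finset.sum_eq_zero fun i hi =>
          absurd (Finset.gcd_eq_zero_iff.1 hg i hi) (hd i).ne'
      · exact hn₀ _ (le_trans (by omega) (Nat.le_mul_of_pos_left k hg)) (dvd_mul_right _ _)
    have := topH_ne_bot_of_content_ne_top d I hc hmem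
    simpa [mul_neg] using this

end TopLocalCohomology
end
open TopLocalCohomology in
theorem mainTheorem2 {R₀ : Type*} [CommRing R₀] [IsDomain R₀] [IsNoetherianRing R₀]
    {s : ℕ} (d : Fin s → ℕ) (hd : ∀ i, 0 < d i)
    (I : Ideal (MvPolynomial (Fin s) R₀))
    {r : ℕ} (f : Fin r → MvPolynomial (Fin s) R₀) (e : Fin r → ℕ)
    (hf : ∀ j, MvPolynomial.IsWeightedHomogeneous d (f j) (e j))
    (hI : I = Ideal.span (Set.range f)) :
    List.TFAE [content I = ⊤,
      ∃ n ∈ degreeSet d, topH d I (-(n : ℤ)) = ⊥,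
      ∀ n ∈ degreeSet d, topH d I (-(n : ℤ)) = ⊥] ∧
    (∀ n : ℤ, ¬ ((Finset.univ.gcd d : ℕ) : ℤ) ∣ n → topH d I n = ⊥) ∧
    AsymptoticallyGapFree (fun n : ℤ => topH d I (((Finset.univ.gcd d : ℕ) : ℤ) * n)) ∧
    (Finset.univ.gcd d = 1 → AsymptoticallyGapFree (topH d I)) := by
  have hvan : content I = ⊤ → ∀ n : ℤ, topH d I n = ⊥ :=
    topH_eq_bot_of_content_eq_top d hd I f e hf hI
  have hgap := asymptoticallyGapFree_topH d hd I hvan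
  refine ⟨?_, topH_eq_bot_of_not_dvd d I, hgap, fun hg => ?_⟩
  · tfae_have 1 → 3 := fun hc n _ => hvan hc _
    tfae_have 3 → 2 := fun h =>
      ⟨_, ⟨fun _ => 1, fun _ => one_pos, rfl⟩, h _ ⟨fun _ => 1, fun _ => one_pos, rfl⟩⟩
    tfae_have 2 → 1 := by
      rintro ⟨n, hn, h⟩
      by_contra hc
      exact topH_ne_bot_of_content_ne_top d I hc hn h
    tfae_finish
  · simpa [hg] using hgap
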